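/- **Setting.** For $n\ge 0$ queues, let $G$ be a (simple) interference graph on $\{1,\dots,n\}$ with feasible schedules $\mathcal I(G)=\{\rho\in\{0,1\}^n:\rho_i+\rho_j\le 1 \text{ for every edge } ij\}$, let $\mathcal H\subset(0,1]$ be a finite set of channel levels with $\max\mathcal H=1$, and let $\gamma=(\gamma^{u\to v})_{u\ne v}$ be irreducible transition rates on $\mathcal H^n$ with stationary distribution $(\pi_c)_{c\in\mathcal H^n}$. Put $$C(\gamma,G)=\Big\{\Big(\sum_{c}\pi_c\sum_{\rho\in\mathcal I(G)}\alpha_{\rho,c}\,c_i\rho_i\Big)_{i}:\ \alpha_{\rho,c}\ge 0,\ \sum_{\rho}\alpha_{\rho,c}=1\ \ \forall c\Big\},$$ $$\Lambda^o(\gamma,G)=\{\lambda\in\mathbb R_+^n:\ \lambda<\lambda' \text{ componentwise for some } \lambda'\in C(\gamma,G)\}.$$ An *A-CSMA algorithm* for $n$ queues is given by functions $f_i,g_i:[0,1]\to(0,\infty)$, $1\le i\le n$. Under it $(\sigma(t),c(t))_{t\ge0}$ is a continuous-time càdlàg Markov process on $\mathcal I(G)\times\mathcal H^n$, with arbitrary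 initial distribution, in which $c$ jumps from $u$ to $v$ at rate $\gamma^{u\to v}$, $\sigma_i$ jumps from $0$ to $1$ at rate $f_i(c_i)$ when $\sigma_j=0$ for all neighbours $j$ of $i$, and $\sigma_i$ jumps from $1$ to $0$ at rate $g_i(c_i)$. Work arrives at queue $i$ according to a nondecreasing right-continuous cumulative process $A_i$ with $A_i(0)=0$ and rate $\lambda_i>0$, i.e. $E[A_i(t+1)-A_i(t)\mid A_i(t)]=\lambda_i$ for $t\in\mathbb Z_+$ and $A_i(t)/t\to\lambda_i$ almost surely. The queues satisfy $Q_i(0)=0$, $Q_i\ge 0$ and, for $0\le s<t$, $$Q_i(t)=Q_i(s)-\int_s^t\sigma_i(r)c_i(r)\mathbf 1_{\{Q_i(r)>0\}}\,dr+A_i(t)-A_i(s).$$ With $D_i(t)=\int_0^t\sigma_i(r)c_i(r)\mathbf 1_{\{Q_i(r)>0\}}\,dr$, the network is *rate-stable* for $\lambda$ if $\lim_{t\to\infty}D_i(t)/t=\lambda_i$ for all $i$ with probability one. For $k:[0,1]\to\mathbb R$, EXP($k$)-A-CSMA is the class of A-CSMA algorithms (for any $n$) such that, for some $r\in\mathbb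 R^n$, $\log\frac{f_i(x)}{g_i(x)}=r_i\,k(x)$ for all $i$ and all $x\in[0,1]$. EXP-A-CSMA is the class obtained for $k(x)=x$. **Theorem (Uniqueness).** Let $k:[0,1]\to\mathbb R$ be nonnegative and continuous. Suppose that for all $n,G,\mathcal H,\gamma$ as above and every $\lambda\in\Lambda^o(\gamma,G)$ with all $\lambda_i>0$ there is an EXP($k$)-A-CSMA algorithm that is rate-stable for $\lambda$ (it suffices that this holds for one realisation of the network, that is, for some probability space carrying processes $(\sigma,c)$, $A$, $Q$ as above). Then $$\text{EXP}(k)\text{-A-CSMA}=\text{EXP-A-CSMA};$$ moreover $k$ is linear with $k(0)=0$: there is $b>0$ with $k(x)=bx$ for all $x\in[0,1]$. -/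

import Mathlib

open MeasureTheory ProbabilityTheory Filter Topology Set

noncomputable section

namespace CSMA

/-! ### Finite-state continuous-time Markov processes -/

/-- The generator matrix of the jump rates `q` (only the off-diagonal values of `q` matter). -/
def generator {S : Type*} [Fintype S] [DecidableEq S] (q : S → S → ℝ) : Matrix S S ℝ :=
  fun x y => if x = y then -∑ z ∈ Finset.univ.erase x, q x z else q x y

/-- `p` is a stationary probability distribution of the Markov process with jump rates `q`. -/
def IsStationary {S : Type*} [Fintype S] [DecidableEq S] (q : S → S → ℝ) (p : S → ℝ) : Prop :=
  (∀ x, 0 ≤ p x) ∧ ∑ x, p x = 1 ∧ ∀ y, ∑ x, p x * generator q x y = 0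

/-- `q` is a family of transition rates (nonnegative off the diagonal) that is irreducible: every
state is reachable from every state through transitions of positive rate. -/
def IsIrreducibleRate {S : Type*} (q : S → S → ℝ) : Prop :=
  (∀ x y, x ≠ y → 0 ≤ q x y) ∧
    ∀ x y, Relation.ReflTransGen (fun a b => a ≠ b ∧ 0 < q a b) x y

/-- `X t`, `t ≥ 0`, is a time-homogeneous Markov process with jump rates `q` under `P`: its paths
are càdlàg (for the discrete topology of the state space), and its finite-dimensional
distributions are those of the transition semigroup `exp (t L)`, where `L` is the generator
of `q`. The initial distribution is arbitrary. Negative times play no role. -/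
structure IsMarkovProcess {S : Type*} [Fintype S] [DecidableEq S] (q : S → S → ℝ)
    {Ω : Type*} [MeasurableSpace Ω] (P : Measure Ω) (X : ℝ → Ω → S) : Prop where
  measurable : ∀ t, 0 ≤ t → ∀ x, MeasurableSet {ω | X t ω = x}
  right_cont : ∀ ω t, 0 ≤ t → ∀ᶠ s in 𝓝[>] t, X s ω = X t ω
  left_lim : ∀ ω t, 0 < t → ∃ x, ∀ᶠ s in 𝓝[<] t, X s ω = x
  fdd : ∀ (N : ℕ) (t : ℕ → ℝ) (x : ℕ → S), 0 ≤ t 0 → Monotone t →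
    P {ω | ∀ j ≤ N, X (t j) ω = x j} =
      P {ω | X (t 0) ω = x 0} *
        ∏ j ∈ Finset.range N, ENNReal.ofReal
          (NormedSpace.exp ((t (j + 1) - t j) • generator q) (x j) (x (j + 1)))

/-! ### Schedules, channels and the capacity region -/

/-- The set `I(G)` of feasible schedules: `σ i = true` means that queue `i` transmits, and no two
interfering queues transmit together. -/
abbrev Schedule {n : ℕ} (G : SimpleGraph (Fin n)) : Type :=
  {σ : Fin n → Bool // ∀ i j, G.Adj i j → ¬ (σ i = true ∧ σ j = true)}

instance {n : ℕ} (G : SimpleGraph (Fin n)) : Fintype (Schedule G) := Fintype.ofFinite _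

/-- The entry `σ i` of a schedule as a real number `0` or `1`. -/
def Schedule.ind {n : ℕ} {G : SimpleGraph (Fin n)} (σ : Schedule G) (i : Fin n) : ℝ :=
  if σ.1 i = true then 1 else 0

/-- Channel states: every queue has a channel level in the finite set `H ⊆ [0, 1]`. -/
abbrev ChannelState (n : ℕ) (H : Finset unitInterval) : Type :=
  Fin n → {h : unitInterval // h ∈ H}

/-- The level `c i ∈ [0, 1]` of queue `i` in the channel state `c`. -/
def ChannelState.level {n : ℕ} {H : Finset unitInterval} (c : ChannelState n H) (i : Fin n) :
    unitInterval := (c i).1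

/-- The capacity region `C(γ, G)`. -/
def capacityRegion {n : ℕ} (G : SimpleGraph (Fin n)) (H : Finset unitInterval)
    (γ : ChannelState n H → ChannelState n H → ℝ) : Set (Fin n → ℝ) :=
  {v | ∃ p : ChannelState n H → ℝ, IsStationary γ p ∧
    ∃ α : Schedule G → ChannelState n H → ℝ,
      (∀ ρ c, 0 ≤ α ρ c) ∧ (∀ c, ∑ ρ, α ρ c = 1) ∧
      ∀ i, v i = ∑ c, p c * ∑ ρ, α ρ c * ((ChannelState.level c i : ℝ) * Schedule.ind ρ i)}

/-- The set `Λᵒ(γ, G)` of strictly admissible arrival rates. -/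
def strictlyAdmissible {n : ℕ} (G : SimpleGraph (Fin n)) (H : Finset unitInterval)
    (γ : ChannelState n H → ChannelState n H → ℝ) : Set (Fin n → ℝ) :=
  {lam | (∀ i, 0 ≤ lam i) ∧ ∃ v ∈ capacityRegion G H γ, ∀ i, lam i < v i}

/-! ### A-CSMA algorithms -/

/-- An A-CSMA algorithm for `n` queues: the functions `f i, g i : [0, 1] → (0, ∞)` that give the
backoff rate and the inverse mean holding time of queue `i` in terms of its channel level. -/
structure ACSMA (n : ℕ) where
  f : Fin n → unitInterval → ℝ
  g : Fin n → unitInterval → ℝ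
  f_pos : ∀ i x, 0 < f i x
  g_pos : ∀ i x, 0 < g i x

/-- The class EXP(`k`)-A-CSMA: `log (f i x / g i x) = r i * k x` on `[0, 1]` for some real
constants `r i`. -/
def expKACSMA (n : ℕ) (k : unitInterval → ℝ) : Set (ACSMA n) :=
  {a | ∃ r : Fin n → ℝ, ∀ i x, Real.log (a.f i x / a.g i x) = r i * k x}

/-- The class EXP-A-CSMA: `log (f i x / g i x) = r i * x` on `[0, 1]` for some real constants
`r i`. -/
def expACSMA (n : ℕ) : Set (ACSMA n) :=
  {a | ∃ r : Fin n → ℝ, ∀ i x, Real.log (a.f i x / a.g i x) = r i * (x : ℝ)}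

/-- The transition rates of the process `(σ(t), c(t))` under an A-CSMA algorithm, for channel
transition rates `γ`. The target of a transition is a feasible schedule, so a queue can
only be switched on when none of its neighbours transmits. -/
def acsmaRate {n : ℕ} (G : SimpleGraph (Fin n)) (H : Finset unitInterval)
    (γ : ChannelState n H → ChannelState n H → ℝ) (a : ACSMA n)
    (s s' : Schedule G × ChannelState n H) : ℝ :=
  (if s'.1 = s.1 then γ s.2 s'.2 else 0) +
  (if s'.2 = s.2 then
    ∑ i, ((if s.1.1 i = false ∧ s'.1.1 = Function.update s.1.1 i true
            then a.f i (ChannelState.level s.2 i) else 0) +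
          (if s.1.1 i = true ∧ s'.1.1 = Function.update s.1.1 i false
            then a.g i (ChannelState.level s.2 i) else 0))
  else 0)

/-! ### Queues and rate stability -/

/-- `A t` is the work that arrives in `(0, t]`, and work arrives at rate `l`:
`E[A(t, t+1) | A(0, t)] = lim A(0, t) / t = l` for integers `t ≥ 0`. -/
structure IsArrivalProcess {Ω : Type*} [MeasurableSpace Ω] (P : Measure Ω)
    (A : ℝ → Ω → ℝ) (l : ℝ) : Prop where
  measurable : ∀ t, 0 ≤ t → Measurable (A t)
  zero : ∀ ω, A 0 ω = 0
  mono : ∀ ω, MonotoneOn (fun t => A t ω) (Ici 0)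
  right_cont : ∀ ω t, 0 ≤ t → ContinuousWithinAt (fun s => A s ω) (Ici t) t
  integrable : ∀ t : ℕ, Integrable (fun ω => A (t + 1) ω - A t ω) P
  condExp : ∀ t : ℕ,
    P[fun ω => A (t + 1) ω - A t ω | MeasurableSpace.comap (A t) inferInstance] =ᵐ[P] fun _ => l
  rate : ∀ᵐ ω ∂P, Tendsto (fun t => A t ω / t) atTop (𝓝 l)

/-- The actual service rate `σ_i(t) c_i(t) 1{Q_i(t) > 0}` of queue `i`. -/
def serviceRate {n : ℕ} {G : SimpleGraph (Fin n)} {H : Finset unitInterval} {Ω : Type*}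
    (X : ℝ → Ω → Schedule G × ChannelState n H) (Q : Fin n → ℝ → Ω → ℝ)
    (i : Fin n) (ω : Ω) (t : ℝ) : ℝ :=
  Schedule.ind (X t ω).1 i * (ChannelState.level (X t ω).2 i : ℝ) *
    (if 0 < Q i t ω then 1 else 0)

/-- The cumulative actual departure process `D_i(t)`. -/
def departures {n : ℕ} {G : SimpleGraph (Fin n)} {H : Finset unitInterval} {Ω : Type*}
    (X : ℝ → Ω → Schedule G × ChannelState n H) (Q : Fin n → ℝ → Ω → ℝ)
    (i : Fin n) (t : ℝ) (ω : Ω) : ℝ :=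
  ∫ r in (0 : ℝ)..t, serviceRate X Q i ω r

/-- `X = (σ, c)`, `A` and `Q` are the schedule-and-channel process, the arrivals and the queue
lengths of a network that runs the A-CSMA algorithm `a` and starts empty. -/
structure IsNetwork {n : ℕ} (G : SimpleGraph (Fin n)) (H : Finset unitInterval)
    (γ : ChannelState n H → ChannelState n H → ℝ) (lam : Fin n → ℝ) (a : ACSMA n)
    {Ω : Type*} [MeasurableSpace Ω] (P : Measure Ω)
    (X : ℝ → Ω → Schedule G × ChannelState n H) (A Q : Fin n → ℝ → Ω → ℝ) : Prop where
  markov : IsMarkovProcess (acsmaRate G H γ a) P X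
  arrivals : ∀ i, IsArrivalProcess P (A i) (lam i)
  queue_zero : ∀ i ω, Q i 0 ω = 0
  queue_nonneg : ∀ i ω t, 0 ≤ t → 0 ≤ Q i t ω
  service_integrable : ∀ i ω t, 0 ≤ t →
    IntervalIntegrable (serviceRate X Q i ω) volume 0 t
  dynamics : ∀ i ω s t, 0 ≤ s → s < t →
    Q i t ω = Q i s ω - (∫ r in s..t, serviceRate X Q i ω r) + (A i t ω - A i s ω)

/-- Rate stability: the departure rates equal the arrival rates with probability one. -/
def RateStable {n : ℕ} {G : SimpleGraph (Fin n)} {H : Finset unitInterval} (lam : Fin n → ℝ)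
    {Ω : Type*} [MeasurableSpace Ω] (P : Measure Ω)
    (X : ℝ → Ω → Schedule G × ChannelState n H) (Q : Fin n → ℝ → Ω → ℝ) : Prop :=
  ∀ᵐ ω ∂P, ∀ i, Tendsto (fun t => departures X Q i t ω / t) atTop (𝓝 (lam i))

/-- The conclusion of the optimality theorem for the class EXP(`k`)-A-CSMA: for all interference
graphs `G`, finite sets `H ⊆ (0, 1]` of channel levels with `max H = 1`, irreducible channel
transition rates `γ` and strictly admissible (positive) arrival rates there is an algorithm of
the class that is rate-stable. Only one realisation of the network is asked for. -/
def OptimalityHolds (k : unitInterval → ℝ) : Prop :=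
  ∀ (n : ℕ) (G : SimpleGraph (Fin n)) (H : Finset unitInterval)
    (γ : ChannelState n H → ChannelState n H → ℝ) (lam : Fin n → ℝ),
    (0 : unitInterval) ∉ H → (1 : unitInterval) ∈ H → IsIrreducibleRate γ →
    (∀ i, 0 < lam i) → lam ∈ strictlyAdmissible G H γ →
    ∃ a ∈ expKACSMA n k, ∃ (Ω : Type) (_ : MeasurableSpace Ω) (P : Measure Ω)
      (X : ℝ → Ω → Schedule G × ChannelState n H) (A Q : Fin n → ℝ → Ω → ℝ),
      IsProbabilityMeasure P ∧ IsNetwork G H γ lam a P X A Q ∧ RateStable lam P X Q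

end CSMA

end

noncomputable section

namespace CSMA

/-! ### The transition semigroup -/

section Semigroup

variable {S : Type*} [Fintype S] [DecidableEq S]

/-! Optimality is tested on one interference graph, the path in which queue `2` blocks the queues
`0` and `1`, with all channel states communicating at rate one. There the best schedule at levels
`x, y, z` is decided by comparing `x + y` with `z`, and the aim is that the weights `r 0 * k x + r 1
* k y` and `r 2 * k z` must compare in the same way.

Rate stability yields a stationary law of schedule and channel whose mean service is at least the
arrival rate (a limit of time averages, `IsMarkovProcess.exists_isStationary`). Arrival rates close
to a capacity point of maximal total throughput force this law to give almost no mass to suboptimal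
pairs (`OptimalityHolds.exists_concentrated`).

The stationary law need not have product form, since the channel need not be slow compared with the
schedule. Flows replace the explicit formula: where `ends` is optimal, channel jumps keep feeding
mass into `centre`, and this mass has to leave by schedule switches towards `ends`. A net flow along
a path makes the ratio of probability to product-form weight decrease along it; as `ends` is the
more probable state, its weight is strictly larger. The reverse case is symmetric
(`OptimalityHolds.exists_weights`).

The vector `r` depends on the finite set of levels. Normalisation and compactness of the sphere give
one `r ≠ 0` with weak inequalities at all positive levels, and continuity turns them into `r 0 * K x
+ r 1 * K y = r 2 * K (x + y)`. As `k` is not constant, the coefficients agree, and Cauchy's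
equation on the interval makes `k` linear. -/

open scoped Matrix.Norms.Operator in
theorem exp_apply_nonneg_of_nonneg (M : Matrix S S ℝ) (hM : ∀ x y, 0 ≤ M x y) (x y : S) :
    0 ≤ NormedSpace.exp M x y := by
  have hpow : ∀ (n : ℕ) x y, 0 ≤ (M ^ n) x y := by
    intro n
    induction n with
    | zero =>
      intro x y
      rw [pow_zero, Matrix.one_apply]
      split_ifs <;> norm_num
    | succ n ih =>
      intro x y
      rw [pow_succ, Matrix.mul_apply]
      exact Finset.sum_nonneg fun z _ => mul_nonneg (ih x z) (hM z y)
  have h := NormedSpace.exp_series_hasSum_exp' (𝕂 := ℝ) M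
  have h' := (Pi.hasSum.1 (Pi.hasSum.1 h x)) y
  refine h'.nonneg fun n => ?_
  have := hpow n x y
  simp only [Matrix.smul_apply, smul_eq_mul]
  positivity

/-- Uniformisation: adding a large multiple of the identity makes the generator entrywise
nonnegative, and since the shift commutes it only contributes a positive scalar factor to the
exponential. -/
theorem exp_smul_generator_nonneg {q : S → S → ℝ} (hq : ∀ x y, x ≠ y → 0 ≤ q x y) {t : ℝ}
    (ht : 0 ≤ t) (x y : S) : 0 ≤ NormedSpace.exp (t • generator q) x y := by
  set c : ℝ := ∑ x, |generator q x x| with hc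
  have hdecomp : t • generator q =
      Matrix.diagonal (fun _ => -(t * c)) + t • (generator q + Matrix.diagonal fun _ => c) := by
    ext a b
    by_cases h : a = b
    · subst h; simp
    · simp [h]
  have hcomm : Commute (Matrix.diagonal (fun _ : S => -(t * c)))
      (t • (generator q + Matrix.diagonal fun _ => c)) := by
    rw [← Matrix.scalar_apply]
    exact Matrix.scalar_commute _ (fun _ => Commute.all _ _) _
  rw [hdecomp, Matrix.exp_add_of_commute _ _ hcomm, Matrix.exp_diagonal, Matrix.diagonal_mul,
    Pi.coe_exp, ← Real.exp_eq_exp_ℝ]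
  refine mul_nonneg (Real.exp_pos _).le (exp_apply_nonneg_of_nonneg _ (fun a b => ?_) x y)
  rw [Matrix.smul_apply, smul_eq_mul]
  refine mul_nonneg ht ?_
  by_cases h : a = b
  · subst h
    have h1 : |generator q a a| ≤ c :=
      Finset.single_le_sum (f := fun x => |generator q x x|) (fun _ _ => abs_nonneg _)
        (Finset.mem_univ a)
    have h2 := neg_abs_le (generator q a a)
    simp; linarith
  · simp [h, generator, hq a b h]

open scoped Matrix.Norms.Operator in
theorem hasDerivAt_vecMul_exp (L : Matrix S S ℝ) (p : S → ℝ) (y : S) (t : ℝ) :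
    HasDerivAt (fun u : ℝ => ∑ x, p x * NormedSpace.exp (u • L) x y)
      (∑ z, (∑ x, p x * NormedSpace.exp (t • L) x z) * L z y) t := by
  have h := hasDerivAt_exp_smul_const (𝕂 := ℝ) L t
  have h1 : ∀ x, HasDerivAt (fun u : ℝ => NormedSpace.exp (u • L) x y)
      ((NormedSpace.exp (t • L) * L) x y) t := fun x =>
    (hasDerivAt_pi.1 ((hasDerivAt_pi.1 h) x)) y
  have h2 := HasDerivAt.fun_sum (u := Finset.univ) fun x _ => (h1 x).const_mul (p x)
  convert! h2 using 1
  simp only [Matrix.mul_apply, Finset.sum_mul, Finset.mul_sum]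
  rw [Finset.sum_comm]
  simp only [mul_assoc]

theorem continuous_vecMul_exp (L : Matrix S S ℝ) (p : S → ℝ) (y : S) :
    Continuous fun u : ℝ => ∑ x, p x * NormedSpace.exp (u • L) x y :=
  continuous_iff_continuousAt.2 fun t => (hasDerivAt_vecMul_exp L p y t).continuousAt

end Semigroup

/-! ### Occupation times of a Markov process -/

namespace IsMarkovProcess

variable {S : Type*} [Fintype S] [DecidableEq S] {q : S → S → ℝ} {Ω : Type*} [MeasurableSpace Ω]
  {P : Measure Ω} {X : ℝ → Ω → S}

theorem measurable_comp (hX : IsMarkovProcess q P X) (h : S → ℝ) {t : ℝ} (ht : 0 ≤ t) :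
    Measurable fun ω => h (X t ω) := by
  let _ : MeasurableSpace S := ⊤
  have : Measurable (X t) := measurable_to_countable' fun x => hX.measurable t ht x
  exact (measurable_from_top (f := h)).comp this

/-- Joint measurability follows from right continuity by rounding time up to multiples of `1 / N`.
Freezing negative times at `0` avoids any condition on them. -/
theorem measurable_uncurry (hX : IsMarkovProcess q P X) (h : S → ℝ) :
    Measurable fun p : ℝ × Ω => h (X (max p.1 0) p.2) := by
  let u : ℕ → ℝ → ℝ := fun N r => (⌈max r 0 * N⌉₊ : ℝ) / N
  refine measurable_of_tendsto_metrizable (f := fun N p => h (X (u N p.1) p.2)) (fun N => ?_) ?_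
  · have h1 : Measurable fun p : ℕ × Ω => h (X ((p.1 : ℝ) / N) p.2) :=
      measurable_from_prod_countable_right fun m =>
        hX.measurable_comp h (div_nonneg m.cast_nonneg N.cast_nonneg)
    have h2 : Measurable fun p : ℝ × Ω => (⌈max p.1 0 * N⌉₊, p.2) := by
      refine Measurable.prodMk ?_ measurable_snd
      exact Nat.measurable_ceil.comp ((measurable_fst.max measurable_const).mul_const _)
    exact h1.comp h2
  · refine tendsto_pi_nhds.2 fun p => tendsto_const_nhds.congr' ?_
    obtain ⟨r, ω⟩ := p
    have hr : (0 : ℝ) ≤ max r 0 := le_max_right _ _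
    obtain ⟨v, hv, hsub⟩ := mem_nhdsGT_iff_exists_Ioo_subset.1 (hX.right_cont ω _ hr)
    have hlim : Tendsto (fun N : ℕ => u N r) atTop (𝓝 (max r 0)) :=
      (tendsto_nat_ceil_mul_div_atTop hr).comp tendsto_natCast_atTop_atTop
    filter_upwards [hlim.eventually (gt_mem_nhds hv), eventually_gt_atTop 0] with N hN hN0
    have hN0' : (0 : ℝ) < N := by exact_mod_cast hN0
    have hle : max r 0 ≤ u N r := by
      rw [le_div_iff₀ hN0']
      exact Nat.le_ceil _
    rcases hle.eq_or_lt with heq | hlt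
    · simp only [← heq]
    · have : X (u N r) ω = X (max r 0) ω := hsub ⟨hlt, hN⟩
      simp only [this]

theorem measureReal_eq [IsProbabilityMeasure P] (hX : IsMarkovProcess q P X)
    (hq : ∀ x y, x ≠ y → 0 ≤ q x y) {t : ℝ} (ht : 0 ≤ t) (y : S) :
    P.real {ω | X t ω = y} =
      ∑ x, P.real {ω | X 0 ω = x} * NormedSpace.exp (t • generator q) x y := by
  have hpair : ∀ x, P {ω | X 0 ω = x ∧ X t ω = y} = P {ω | X 0 ω = x} *
      ENNReal.ofReal (NormedSpace.exp (t • generator q) x y) := by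
    intro x
    have h := hX.fdd 1 (fun j => if j = 0 then 0 else t) (fun j => if j = 0 then x else y)
      (by simp) (by
        intro a b hab
        by_cases ha : a = 0
        · by_cases hb : b = 0 <;> simp [ha, hb, ht]
        · have hb : b ≠ 0 := by omega
          simp [ha, hb])
    have hset : {ω | ∀ j ≤ 1, X (if j = 0 then 0 else t) ω = if j = 0 then x else y} =
        {ω | X 0 ω = x ∧ X t ω = y} := by
      ext ω
      constructor
      · intro hω
        exact ⟨by simpa using hω 0 (by norm_num), by simpa using hω 1 le_rfl⟩
      · rintro ⟨h0, h1⟩ j hj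
        interval_cases j <;> simpa
    simp only [hset] at h
    simpa using h
  have hunion : {ω | X t ω = y} = ⋃ x ∈ (Finset.univ : Finset S),
      {ω | X 0 ω = x ∧ X t ω = y} := by
    ext ω; simp
  rw [hunion, measureReal_biUnion_finset]
  · refine Finset.sum_congr rfl fun x _ => ?_
    rw [measureReal_def, hpair x, ENNReal.toReal_mul,
      ENNReal.toReal_ofReal (exp_smul_generator_nonneg hq ht x y), measureReal_def]
  · intro a _ b _ hab
    refine Set.disjoint_left.2 fun ω h1 h2 => hab (h1.1.symm.trans h2.1)
  · intro x _
    exact (hX.measurable 0 le_rfl x).inter (hX.measurable t ht y)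

theorem integral_comp [IsProbabilityMeasure P] (hX : IsMarkovProcess q P X)
    (h : S → ℝ) {t : ℝ} (ht : 0 ≤ t) :
    ∫ ω, h (X t ω) ∂P = ∑ y, P.real {ω | X t ω = y} * h y := by
  have h1 : (fun ω => h (X t ω)) =
      fun ω => ∑ y, ({ω | X t ω = y}.indicator (fun _ => h y) ω) := by
    ext ω
    simp [Set.indicator_apply]
  rw [h1, integral_finsetSum _ fun y _ =>
    (integrable_const (h y)).indicator (hX.measurable t ht y)]
  refine Finset.sum_congr rfl fun y _ => ?_
  rw [integral_indicator_const _ (hX.measurable t ht y), smul_eq_mul]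

theorem integrable_uncurry [IsProbabilityMeasure P] (hX : IsMarkovProcess q P X) (h : S → ℝ)
    (T : ℝ) : Integrable (Function.uncurry fun r ω => h (X (max r 0) ω))
      ((volume.restrict (Ioc 0 T)).prod P) := by
  refine Integrable.of_bound (C := ∑ y, |h y|) (hX.measurable_uncurry h).aestronglyMeasurable ?_
  refine Eventually.of_forall fun p => ?_
  exact Finset.single_le_sum (f := fun y => |h y|) (fun _ _ => abs_nonneg _) (Finset.mem_univ _)

theorem integral_occupation [IsProbabilityMeasure P] (hX : IsMarkovProcess q P X)
    (hq : ∀ x y, x ≠ y → 0 ≤ q x y) (h : S → ℝ) {T : ℝ} (hT : 0 ≤ T) :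
    ∫ ω, (∫ r in (0 : ℝ)..T, h (X (max r 0) ω)) ∂P =
      ∑ y, (∫ r in (0 : ℝ)..T, ∑ x, P.real {ω | X 0 ω = x} *
        NormedSpace.exp (r • generator q) x y) * h y := by
  simp only [intervalIntegral.integral_of_le hT]
  rw [← integral_integral_swap (hX.integrable_uncurry h T)]
  have : ∀ r ∈ Ioc (0 : ℝ) T, ∫ ω, h (X (max r 0) ω) ∂P = ∑ y, (∑ x, P.real {ω | X 0 ω = x} *
        NormedSpace.exp (r • generator q) x y) * h y := by
    intro r hr
    rw [hX.integral_comp h (le_max_right _ _), max_eq_left hr.1.le]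
    refine Finset.sum_congr rfl fun y _ => ?_
    rw [hX.measureReal_eq hq hr.1.le]
  rw [setIntegral_congr_fun measurableSet_Ioc this, integral_finsetSum]
  · exact Finset.sum_congr rfl fun y _ => integral_mul_const _ _
  · intro y _
    have hc := (continuous_vecMul_exp (generator q) (fun x => P.real {ω | X 0 ω = x}) y).mul_const
      (h y)
    exact (hc.integrableOn_Icc (a := 0) (b := T)).mono_set Ioc_subset_Icc_self

/-- If the cumulative rewards `∫ h i (X r) dr` dominate processes that grow at the almost sure rates
`lam i`, then some stationary distribution has mean rewards at least `lam`. -/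
theorem exists_isStationary [IsProbabilityMeasure P] (hX : IsMarkovProcess q P X)
    (hq : ∀ x y, x ≠ y → 0 ≤ q x y) {ι : Type*} (h : ι → S → ℝ) (lam : ι → ℝ)
    (hrate : ∀ i, ∀ᵐ ω ∂P, ∃ D : ℝ → ℝ, Tendsto (fun t => D t / t) atTop (𝓝 (lam i)) ∧
      ∀ t, 0 ≤ t → D t ≤ ∫ r in (0 : ℝ)..t, h i (X (max r 0) ω)) :
    ∃ μ : S → ℝ, IsStationary q μ ∧ ∀ i, lam i ≤ ∑ s, μ s * h i s := by
  set p : ℝ → S → ℝ := fun r y => ∑ x, P.real {ω | X 0 ω = x} *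
    NormedSpace.exp (r • generator q) x y with hp
  have hpc : ∀ y, Continuous fun r => p r y := fun y => continuous_vecMul_exp _ _ y
  have hpP : ∀ r, 0 ≤ r → ∀ y, p r y = P.real {ω | X r ω = y} := fun r hr y =>
    (hX.measureReal_eq hq hr y).symm
  have hp0 : ∀ r, 0 ≤ r → ∀ y, 0 ≤ p r y := fun r hr y => by
    rw [hpP r hr]; exact measureReal_nonneg
  have hpsum : ∀ r, 0 ≤ r → ∑ y, p r y = 1 := fun r hr => by
    have := hX.integral_comp (fun _ => 1) hr
    simp only [mul_one, integral_const, probReal_univ, one_smul] at this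
    rw [this]
    exact Finset.sum_congr rfl fun y _ => hpP r hr y
  have hp1 : ∀ r, 0 ≤ r → ∀ y, p r y ≤ 1 := fun r hr y => by
    rw [hpP r hr]; exact measureReal_le_one
  -- Krylov–Bogoliubov: `m n` is the law averaged over `[0, n + 1]`. By the forward equation the
  -- generator maps it to an increment of `p` divided by `n + 1`, so every limit point is
  -- stationary.
  set m : ℕ → S → ℝ := fun n y => (∫ r in (0 : ℝ)..(n + 1 : ℝ), p r y) / (n + 1) with hm
  have hpos : ∀ n : ℕ, (0 : ℝ) < n + 1 := fun n => by positivity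
  have hmem : ∀ n, m n ∈ stdSimplex ℝ S := by
    intro n
    refine ⟨fun y => div_nonneg (intervalIntegral.integral_nonneg (hpos n).le
      fun r hr => hp0 r hr.1 y) (hpos n).le, ?_⟩
    simp only [hm]
    rw [← Finset.sum_div, ← intervalIntegral.integral_finsetSum
      fun y _ => (hpc y).intervalIntegrable _ _, div_eq_one_iff_eq (hpos n).ne']
    rw [intervalIntegral.integral_congr (g := fun _ => (1 : ℝ))]
    · simp
    · intro r hr
      rw [uIcc_of_le (hpos n).le] at hr
      exact hpsum r hr.1
  obtain ⟨μ, hμ, φ, hφ, hlim⟩ := (isCompact_stdSimplex ℝ S).tendsto_subseq hmem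
  have hlim' : ∀ y, Tendsto (fun n => m (φ n) y) atTop (𝓝 (μ y)) := tendsto_pi_nhds.1 hlim
  refine ⟨μ, ⟨hμ.1, hμ.2, fun y => ?_⟩, fun i => ?_⟩
  · have hgen : ∀ n, ∑ x, m n x * generator q x y = (p (n + 1) y - p 0 y) / (n + 1) := by
      intro n
      have hint := intervalIntegral.integral_eq_sub_of_hasDerivAt (a := 0) (b := (n + 1 : ℝ))
        (fun r _ => hasDerivAt_vecMul_exp (generator q) (fun x => P.real {ω | X 0 ω = x}) y r)
        (Continuous.intervalIntegrable (continuous_finsetSum _ fun z _ =>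
          (hpc z).mul_const _) _ _)
      rw [← hint, intervalIntegral.integral_finsetSum
        fun z _ => ((hpc z).mul_const _).intervalIntegrable _ _, Finset.sum_div]
      refine Finset.sum_congr rfl fun z _ => ?_
      rw [intervalIntegral.integral_mul_const]
      simp only [hm, hp]
      ring
    have h1 : Tendsto (fun n => ∑ x, m (φ n) x * generator q x y) atTop
        (𝓝 (∑ x, μ x * generator q x y)) :=
      tendsto_finsetSum _ fun x _ => (hlim' x).mul_const _
    have h2 : Tendsto (fun n => ∑ x, m n x * generator q x y) atTop (𝓝 0) := by
      refine squeeze_zero_norm (fun n => ?_) (tendsto_one_div_add_atTop_nhds_zero_nat (𝕜 := ℝ))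
      rw [hgen, norm_div, Real.norm_of_nonneg (hpos n).le]
      refine div_le_div_of_nonneg_right ?_ (hpos n).le
      rw [Real.norm_eq_abs, abs_le]
      have a1 := hp0 (n + 1) (hpos n).le y
      have a2 := hp1 (n + 1) (hpos n).le y
      have a3 := hp0 0 le_rfl y
      have a4 := hp1 0 le_rfl y
      constructor <;> linarith
    exact tendsto_nhds_unique h1 (h2.comp hφ.tendsto_atTop)
  · set B : ℝ := ∑ y, |h i y| with hB
    have hhB : ∀ y, |h i y| ≤ B := fun y =>
      Finset.single_le_sum (f := fun y => |h i y|) (fun _ _ => abs_nonneg _) (Finset.mem_univ _)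
    set R : ℕ → Ω → ℝ := fun n ω =>
      (∫ r in (0 : ℝ)..(n + 1 : ℝ), h i (X (max r 0) ω)) / (n + 1) with hR
    have hRint : ∀ n, Integrable (R n) P := by
      intro n
      refine Integrable.div_const ?_ _
      simp only [intervalIntegral.integral_of_le (hpos n).le]
      exact (hX.integrable_uncurry (h i) (n + 1)).integral_prod_right
    have hRB : ∀ n ω, |R n ω| ≤ B := by
      intro n ω
      rw [hR, abs_div, abs_of_pos (hpos n), div_le_iff₀ (hpos n)]
      have := intervalIntegral.norm_integral_le_of_norm_le_const (a := 0) (b := (n + 1 : ℝ))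
        (f := fun r => h i (X (max r 0) ω)) (C := B) fun r _ => hhB _
      simpa [abs_of_pos (hpos n)] using this
    have hRE : ∀ n, ∫ ω, R n ω ∂P = ∑ y, m n y * h i y := by
      intro n
      simp only [hR]
      rw [integral_div, hX.integral_occupation hq (h i) (hpos n).le, Finset.sum_div]
      refine Finset.sum_congr rfl fun y _ => ?_
      simp only [hm, hp]
      ring
    -- The averages `R n` are only bounded below by `D / t` and need not converge; truncation at
    -- `lam i` squeezes them, so dominated convergence applies.
    have hmin : Tendsto (fun n => ∫ ω, min (R n ω) (lam i) ∂P) atTop (𝓝 (∫ _, lam i ∂P)) := by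
      refine tendsto_integral_of_dominated_convergence (fun _ => B + |lam i|)
        (fun n => ((hRint n).inf (integrable_const _)).aestronglyMeasurable)
        (integrable_const _) (fun n => Eventually.of_forall fun ω => ?_) ?_
      · rw [Real.norm_eq_abs, abs_le]
        have a1 := abs_le.1 (hRB n ω)
        have a2 := neg_abs_le (lam i)
        have a3 := le_abs_self (lam i)
        have a4 := abs_nonneg (lam i)
        refine ⟨le_min ?_ ?_, (min_le_right _ _).trans ?_⟩ <;> linarith
      · filter_upwards [hrate i] with ω hω
        obtain ⟨D, hD, hDle⟩ := hω
        have hD' : Tendsto (fun n : ℕ => D (n + 1) / (n + 1)) atTop (𝓝 (lam i)) := by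
          have := hD.comp (tendsto_natCast_atTop_atTop.comp (tendsto_add_atTop_nat 1))
          refine this.congr fun n => ?_
          simp
        have hD'' : Tendsto (fun n : ℕ => min (D (n + 1) / (n + 1)) (lam i)) atTop
            (𝓝 (lam i)) := by
          simpa using hD'.min (tendsto_const_nhds (x := lam i))
        refine tendsto_of_tendsto_of_tendsto_of_le_of_le hD'' tendsto_const_nhds
          (fun n => min_le_min_right _ ?_) (fun n => min_le_right _ _)
        exact div_le_div_of_nonneg_right (hDle _ (hpos n).le) (hpos n).le
    have hE : Tendsto (fun n => ∑ y, m (φ n) y * h i y) atTop (𝓝 (∑ y, μ y * h i y)) :=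
      tendsto_finsetSum _ fun y _ => (hlim' y).mul_const _
    have := le_of_tendsto_of_tendsto' (hmin.comp hφ.tendsto_atTop) hE fun n => by
      simp only [Function.comp]
      rw [← hRE]
      exact integral_mono ((hRint _).inf (integrable_const _)) (hRint _) fun ω => min_le_left _ _
    simpa using this

end IsMarkovProcess

/-! ### Balance equations -/

/-- The irrelevant diagonal rates may be kept because they contribute equally to both sides. -/
theorem IsStationary.balance {S : Type*} [Fintype S] [DecidableEq S] {q : S → S → ℝ} {p : S → ℝ}
    (h : IsStationary q p) (y : S) : ∑ x, p x * q x y = p y * ∑ z, q y z := by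
  have h1 := h.2.2 y
  rw [← Finset.add_sum_erase _ _ (Finset.mem_univ y)] at h1 ⊢
  rw [← Finset.add_sum_erase _ (fun z => q y z) (Finset.mem_univ y)]
  have h2 : ∑ x ∈ Finset.univ.erase y, p x * generator q x y =
      ∑ x ∈ Finset.univ.erase y, p x * q x y := by
    refine Finset.sum_congr rfl fun x hx => ?_
    rw [generator, if_neg (Finset.ne_of_mem_erase hx)]
  rw [h2] at h1
  simp only [generator, if_true] at h1
  linarith

/-- The rate at which the schedule switches from `σ` to `ρ` in the channel state `c`. -/
def switchRate {n : ℕ} {G : SimpleGraph (Fin n)} {H : Finset unitInterval} (a : ACSMA n)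
    (c : ChannelState n H) (σ ρ : Schedule G) : ℝ :=
  ∑ i, ((if σ.1 i = false ∧ ρ.1 = Function.update σ.1 i true
          then a.f i (ChannelState.level c i) else 0) +
        (if σ.1 i = true ∧ ρ.1 = Function.update σ.1 i false
          then a.g i (ChannelState.level c i) else 0))

theorem acsmaRate_eq {n : ℕ} {G : SimpleGraph (Fin n)} {H : Finset unitInterval}
    (γ : ChannelState n H → ChannelState n H → ℝ) (a : ACSMA n)
    (s s' : Schedule G × ChannelState n H) :
    acsmaRate G H γ a s s' = (if s'.1 = s.1 then γ s.2 s'.2 else 0) +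
      (if s'.2 = s.2 then switchRate a s.2 s.1 s'.1 else 0) := rfl

theorem acsmaRate_nonneg {n : ℕ} {G : SimpleGraph (Fin n)} {H : Finset unitInterval}
    {γ : ChannelState n H → ChannelState n H → ℝ} (hγ : ∀ u v, 0 ≤ γ u v) (a : ACSMA n)
    (s s' : Schedule G × ChannelState n H) : 0 ≤ acsmaRate G H γ a s s' := by
  rw [acsmaRate_eq, switchRate]
  refine add_nonneg (ite_nonneg (hγ _ _) le_rfl) (ite_nonneg (Finset.sum_nonneg fun i _ =>
    add_nonneg (ite_nonneg (a.f_pos _ _).le le_rfl) (ite_nonneg (a.g_pos _ _).le le_rfl)) le_rfl)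

/-- The channel rates under which each state jumps to each other state at rate one. -/
abbrev uniformRate (n : ℕ) (H : Finset unitInterval) : ChannelState n H → ChannelState n H → ℝ :=
  fun _ _ => 1

theorem isIrreducibleRate_uniformRate (n : ℕ) (H : Finset unitInterval) :
    IsIrreducibleRate (uniformRate n H) := by
  refine ⟨fun _ _ _ => zero_le_one, fun x y => ?_⟩
  by_cases h : x = y
  · rw [h]
  · exact Relation.ReflTransGen.single ⟨h, zero_lt_one⟩

theorem isStationary_uniformRate (n : ℕ) (H : Finset unitInterval) [Nonempty (ChannelState n H)] :
    IsStationary (uniformRate n H) fun _ => 1 / (Fintype.card (ChannelState n H) : ℝ) := by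
  have hN : (Fintype.card (ChannelState n H) : ℝ) ≠ 0 := by
    exact_mod_cast Fintype.card_ne_zero
  refine ⟨fun _ => by positivity, ?_, fun y => ?_⟩
  · rw [Finset.sum_const, nsmul_eq_mul, Finset.card_univ, mul_one_div_cancel hN]
  rw [← Finset.mul_sum, ← Finset.add_sum_erase _ _ (Finset.mem_univ y)]
  have h2 : ∑ x ∈ Finset.univ.erase y, generator (uniformRate n H) x y =
      ∑ x ∈ Finset.univ.erase y, 1 := by
    refine Finset.sum_congr rfl fun x hx => ?_
    rw [generator, if_neg (Finset.ne_of_mem_erase hx)]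
  rw [h2]
  simp [generator]

section Uniform

variable {n : ℕ} {G : SimpleGraph (Fin n)} {H : Finset unitInterval} {a : ACSMA n}
  {μ : Schedule G × ChannelState n H → ℝ}

theorem balance_uniformRate (h : IsStationary (acsmaRate G H (uniformRate n H) a) μ)
    (ρ : Schedule G) (c : ChannelState n H) :
    ∑ c', μ (ρ, c') + ∑ σ, μ (σ, c) * switchRate a c σ ρ =
      μ (ρ, c) * (Fintype.card (ChannelState n H) + ∑ σ, switchRate a c ρ σ) := by
  have hb := h.balance (ρ, c)
  simp only [acsmaRate_eq, Fintype.sum_prod_type, mul_add, Finset.sum_add_distrib] at hb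
  rw [mul_add]
  convert! hb using 2
  · rw [Finset.sum_comm]
    simp
  · simp
  · simp
  · simp

/-- Summed over schedules, the switching terms cancel in the balance equations and only the
autonomous channel dynamics remain. -/
theorem channel_marginal (h : IsStationary (acsmaRate G H (uniformRate n H) a) μ)
    (c : ChannelState n H) :
    ∑ ρ, μ (ρ, c) = 1 / (Fintype.card (ChannelState n H) : ℝ) := by
  have : Nonempty (ChannelState n H) := ⟨c⟩
  have hN : (Fintype.card (ChannelState n H) : ℝ) ≠ 0 := by
    exact_mod_cast Fintype.card_ne_zero
  have hs := Finset.sum_congr (rfl : Finset.univ = Finset.univ)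
    fun ρ (_ : ρ ∈ Finset.univ) => balance_uniformRate h ρ c
  have htot := h.2.1
  rw [Fintype.sum_prod_type] at htot
  simp only [mul_add, Finset.sum_add_distrib, Finset.mul_sum, htot, ← Finset.sum_mul] at hs
  rw [Finset.sum_comm] at hs
  rw [eq_div_iff hN]
  linarith

end Uniform

/-! ### Concentration of the stationary distribution near the boundary of the capacity region -/

/-- The total service rate of the schedule `ρ` in the channel state `c`. -/
def throughput {n : ℕ} {G : SimpleGraph (Fin n)} {H : Finset unitInterval} (ρ : Schedule G)
    (c : ChannelState n H) : ℝ :=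
  ∑ i, (ChannelState.level c i : ℝ) * Schedule.ind ρ i

theorem Schedule.ind_nonneg {n : ℕ} {G : SimpleGraph (Fin n)} (ρ : Schedule G) (i : Fin n) :
    0 ≤ ρ.ind i := ite_nonneg zero_le_one le_rfl

/-- Departures never exceed the offered service, which is a function of the Markov process alone;
the queues thus drop out. -/
theorem IsNetwork.exists_isStationary {n : ℕ} {G : SimpleGraph (Fin n)} {H : Finset unitInterval}
    {γ : ChannelState n H → ChannelState n H → ℝ} (hγ : ∀ u v, 0 ≤ γ u v) {lam : Fin n → ℝ}
    {a : ACSMA n} {Ω : Type*} [MeasurableSpace Ω] {P : Measure Ω} [IsProbabilityMeasure P]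
    {X : ℝ → Ω → Schedule G × ChannelState n H} {A Q : Fin n → ℝ → Ω → ℝ}
    (hnet : IsNetwork G H γ lam a P X A Q) (hst : RateStable lam P X Q) :
    ∃ μ, IsStationary (acsmaRate G H γ a) μ ∧
      ∀ i, lam i ≤ ∑ s, μ s * ((ChannelState.level s.2 i : ℝ) * Schedule.ind s.1 i) := by
  refine hnet.markov.exists_isStationary (fun x y _ => acsmaRate_nonneg hγ a x y)
    (fun i s => (ChannelState.level s.2 i : ℝ) * Schedule.ind s.1 i) lam fun i => ?_
  filter_upwards [hst] with ω hω
  refine ⟨fun t => departures X Q i t ω, hω i, fun t ht => ?_⟩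
  have hnn : ∀ s : Schedule G × ChannelState n H,
      0 ≤ (ChannelState.level s.2 i : ℝ) * Schedule.ind s.1 i := fun s =>
    mul_nonneg (ChannelState.level s.2 i).2.1 (s.1.ind_nonneg i)
  have hint : IntervalIntegrable (fun r => (fun s : Schedule G × ChannelState n H =>
      (ChannelState.level s.2 i : ℝ) * Schedule.ind s.1 i) (X (max r 0) ω)) volume 0 t := by
    rw [intervalIntegrable_iff, uIoc_of_le ht]
    have hm := (hnet.markov.measurable_uncurry fun s =>
      (ChannelState.level s.2 i : ℝ) * Schedule.ind s.1 i).comp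
        (measurable_id.prodMk (measurable_const (a := ω)))
    refine Integrable.of_bound (C := ∑ s : Schedule G × ChannelState n H,
      ‖(ChannelState.level s.2 i : ℝ) * Schedule.ind s.1 i‖) hm.aestronglyMeasurable ?_
    refine Eventually.of_forall fun r => ?_
    exact Finset.single_le_sum (f := fun s : Schedule G × ChannelState n H =>
      ‖(ChannelState.level s.2 i : ℝ) * Schedule.ind s.1 i‖) (fun _ _ => norm_nonneg _)
      (Finset.mem_univ _)
  refine intervalIntegral.integral_mono_on ht (hnet.service_integrable i ω t ht) hint fun r hr => ?_
  rw [max_eq_left hr.1, serviceRate, mul_comm (Schedule.ind _ _)]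
  split_ifs
  · rw [mul_one]
  · rw [mul_zero]
    exact hnn _

/-- The point `v` served by `best` maximises total throughput. At arrival rates `v i - η` the mean
throughput deficit is at most `n * η`, while each suboptimal pair costs at least a fixed gap `d` per
unit of mass. The covering hypothesis makes `v` positive in each coordinate. -/
theorem OptimalityHolds.exists_concentrated {k : unitInterval → ℝ} (hopt : OptimalityHolds k)
    {n : ℕ} (G : SimpleGraph (Fin n)) {H : Finset unitInterval} (h0 : (0 : unitInterval) ∉ H)
    (h1 : (1 : unitInterval) ∈ H) (best : ChannelState n H → Schedule G)
    (hbest : ∀ (ρ : Schedule G) c, throughput ρ c ≤ throughput (best c) c)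
    (hcov : ∀ i, ∃ c, (best c).1 i = true) {ε : ℝ} (hε : 0 < ε) :
    ∃ a ∈ expKACSMA n k, ∃ μ, IsStationary (acsmaRate G H (uniformRate n H) a) μ ∧
      ∀ (ρ : Schedule G) c, throughput ρ c < throughput (best c) c → μ (ρ, c) ≤ ε := by
  have : Nonempty (ChannelState n H) := ⟨fun _ => ⟨1, h1⟩⟩
  set N : ℝ := (Fintype.card (ChannelState n H) : ℝ) with hN
  have hNpos : 0 < N := by
    rw [hN]; exact_mod_cast Fintype.card_pos
  set v : Fin n → ℝ := fun i =>
    ∑ c, 1 / N * ((ChannelState.level c i : ℝ) * Schedule.ind (best c) i) with hv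
  have hlev : ∀ (c : ChannelState n H) i, 0 < (ChannelState.level c i : ℝ) := by
    intro c i
    refine lt_of_le_of_ne (ChannelState.level c i).2.1 fun h => h0 ?_
    have h2 : ChannelState.level c i = 0 := Subtype.ext h.symm
    rw [← h2]
    exact (c i).2
  have hvpos : ∀ i, 0 < v i := by
    intro i
    obtain ⟨c, hc⟩ := hcov i
    refine Finset.sum_pos' (fun c _ => ?_) ⟨c, Finset.mem_univ _, ?_⟩
    · exact mul_nonneg (by positivity) (mul_nonneg (hlev c i).le (Schedule.ind_nonneg _ i))
    · rw [Schedule.ind, if_pos hc, mul_one]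
      exact mul_pos (by positivity) (hlev c i)
  have hvmem : v ∈ capacityRegion G H (uniformRate n H) := by
    refine ⟨_, isStationary_uniformRate n H, fun ρ c => if ρ = best c then 1 else 0,
      fun ρ c => ite_nonneg zero_le_one le_rfl, fun c => by simp, fun i => ?_⟩
    simp [hv, hN]
  obtain ⟨d, hd, hdpos⟩ : ∃ d : ℝ, (∀ (ρ : Schedule G) (c : ChannelState n H),
      throughput ρ c < throughput (best c) c → d < throughput (best c) c - throughput ρ c) ∧
      0 < d := by
    have he : ∀ᶠ d : ℝ in 𝓝[>] 0, ∀ (ρ : Schedule G) (c : ChannelState n H),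
        throughput ρ c < throughput (best c) c →
          d < throughput (best c) c - throughput ρ c := by
      refine eventually_all.2 fun ρ => eventually_all.2 fun c => ?_
      by_cases h : throughput ρ c < throughput (best c) c
      · filter_upwards [nhdsWithin_le_nhds (gt_mem_nhds (sub_pos.2 h))] with d hd _ using hd
      · exact Eventually.of_forall fun _ h' => absurd h' h
    exact (he.and self_mem_nhdsWithin).exists
  obtain ⟨η, ⟨hηv, hηε⟩, hηpos⟩ : ∃ η : ℝ, ((∀ i, η < v i) ∧ η < ε * d / (n + 1)) ∧ 0 < η := by
    have he : ∀ᶠ η : ℝ in 𝓝[>] 0, (∀ i, η < v i) ∧ η < ε * d / (n + 1) :=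
      nhdsWithin_le_nhds ((eventually_all.2 fun i => gt_mem_nhds (hvpos i)).and
        (gt_mem_nhds (by positivity)))
    exact (he.and self_mem_nhdsWithin).exists
  obtain ⟨a, ha, Ω, mΩ, P, X, A, Q, hP, hnet, hst⟩ := hopt n G H (uniformRate n H)
    (fun i => v i - η) h0 h1 (isIrreducibleRate_uniformRate n H) (fun i => sub_pos.2 (hηv i))
    ⟨fun i => (sub_pos.2 (hηv i)).le, v, hvmem, fun i => sub_lt_self _ hηpos⟩
  obtain ⟨μ, hμ, hlam⟩ := hnet.exists_isStationary (fun _ _ => zero_le_one) hst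
  refine ⟨a, ha, μ, hμ, fun ρ c hlt => ?_⟩
  have hsum : ∑ s, μ s * (throughput (best s.2) s.2 - throughput s.1 s.2) ≤ n * η := by
    have e1 : ∑ i, (v i - η) ≤ ∑ s, μ s * throughput s.1 s.2 := by
      calc ∑ i, (v i - η) ≤ _ := Finset.sum_le_sum fun i _ => hlam i
        _ = _ := by
          rw [Finset.sum_comm]
          simp only [throughput, Finset.mul_sum]
    have e2 : ∑ s, μ s * throughput (best s.2) s.2 = ∑ i, v i := by
      rw [Fintype.sum_prod_type_right]
      simp only [← Finset.sum_mul]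
      simp only [channel_marginal hμ, hv, throughput, Finset.mul_sum]
      rw [Finset.sum_comm]
    have e3 : ∑ i, (v i - η) = ∑ i, v i - n * η := by simp
    simp only [mul_sub, Finset.sum_sub_distrib]
    linarith
  have hterm : μ (ρ, c) * (throughput (best c) c - throughput ρ c) ≤ n * η :=
    (Finset.single_le_sum (f := fun s : Schedule G × ChannelState n H =>
      μ s * (throughput (best s.2) s.2 - throughput s.1 s.2))
      (fun s _ => mul_nonneg (hμ.1 s) (sub_nonneg.2 (hbest _ _))) (Finset.mem_univ (ρ, c))).trans
      hsum
  have hnη : n * η ≤ ε * d := by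
    rw [lt_div_iff₀ (by positivity)] at hηε
    nlinarith
  have hle : μ (ρ, c) * d ≤ ε * d :=
    (mul_le_mul_of_nonneg_left (hd ρ c hlt).le (hμ.1 _)).trans (hterm.trans hnη)
  exact le_of_mul_le_mul_right hle hdpos

/-! ### The path with three queues -/

/-- The interference graph in which the queue `2` interferes with `0` and with `1`. -/
def pathGraph : SimpleGraph (Fin 3) where
  Adj i j := (i = 2 ∧ j ≠ 2) ∨ (i ≠ 2 ∧ j = 2)
  symm := ⟨fun i j h => by tauto⟩
  loopless := ⟨fun i h => by tauto⟩

namespace pathGraph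

def idle : Schedule pathGraph := ⟨![false, false, false], by unfold pathGraph; decide⟩
def left : Schedule pathGraph := ⟨![true, false, false], by unfold pathGraph; decide⟩
def right : Schedule pathGraph := ⟨![false, true, false], by unfold pathGraph; decide⟩
def ends : Schedule pathGraph := ⟨![true, true, false], by unfold pathGraph; decide⟩
def centre : Schedule pathGraph := ⟨![false, false, true], by unfold pathGraph; decide⟩

theorem univ_schedule :
    (Finset.univ : Finset (Schedule pathGraph)) = {idle, left, right, ends, centre} := by
  refine (Finset.eq_univ_iff_forall.2 fun σ => ?_).symm
  obtain ⟨σ, hσ⟩ := σ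
  have h02 := hσ 0 2 (by unfold pathGraph; decide)
  have h12 := hσ 1 2 (by unfold pathGraph; decide)
  simp only [Finset.mem_insert, Finset.mem_singleton, Subtype.ext_iff, idle, left, right, ends,
    centre, funext_iff, Fin.forall_fin_succ]
  rcases h0 : σ 0 <;> rcases h1 : σ 1 <;> rcases h2 : σ 2 <;> simp_all

theorem sum_schedule (F : Schedule pathGraph → ℝ) :
    ∑ ρ, F ρ = F idle + F left + F right + F ends + F centre := by
  rw [univ_schedule]
  rw [Finset.sum_insert, Finset.sum_insert, Finset.sum_insert, Finset.sum_insert,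
    Finset.sum_singleton]
  · ring
  all_goals simp [idle, left, right, ends, centre]

variable {H : Finset unitInterval}

theorem throughput_idle (c : ChannelState 3 H) : throughput idle c = 0 := by
  simp [throughput, idle, Schedule.ind, Fin.sum_univ_three]

theorem throughput_left (c : ChannelState 3 H) : throughput left c = (c 0).1 := by
  simp [throughput, left, Schedule.ind, Fin.sum_univ_three, ChannelState.level]

theorem throughput_right (c : ChannelState 3 H) : throughput right c = (c 1).1 := by
  simp [throughput, right, Schedule.ind, Fin.sum_univ_three, ChannelState.level]

theorem throughput_ends (c : ChannelState 3 H) :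
    throughput ends c = ((c 0).1 : ℝ) + (c 1).1 := by
  simp [throughput, ends, Schedule.ind, Fin.sum_univ_three, ChannelState.level]

theorem throughput_centre (c : ChannelState 3 H) : throughput centre c = (c 2).1 := by
  simp [throughput, centre, Schedule.ind, Fin.sum_univ_three, ChannelState.level]

section Balance

variable {a : ACSMA 3} {μ : Schedule pathGraph × ChannelState 3 H → ℝ}

/-- The excess of the inflow into `ρ` in the channel state `c` over the outflow that is due to
changes of the channel state. -/
def source (μ : Schedule pathGraph × ChannelState 3 H → ℝ) (c : ChannelState 3 H)
    (ρ : Schedule pathGraph) : ℝ :=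
  ∑ c', μ (ρ, c') - Fintype.card (ChannelState 3 H) * μ (ρ, c)

theorem balance_source (h : IsStationary (acsmaRate pathGraph H (uniformRate 3 H) a) μ)
    (c : ChannelState 3 H) (ρ : Schedule pathGraph) :
    source μ c ρ + ∑ σ, μ (σ, c) * switchRate a c σ ρ = μ (ρ, c) * ∑ σ, switchRate a c ρ σ := by
  have := balance_uniformRate h ρ c
  rw [source]
  linarith

theorem balance_centre (h : IsStationary (acsmaRate pathGraph H (uniformRate 3 H) a) μ)
    (c : ChannelState 3 H) :
    source μ c centre + μ (idle, c) * a.f 2 (c 2).1 = μ (centre, c) * a.g 2 (c 2).1 := by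
  have := balance_source h c centre
  simpa [sum_schedule, switchRate, Fin.sum_univ_three, idle, left, right, ends, centre,
    funext_iff, Fin.forall_fin_succ, Function.update_apply, ChannelState.level] using this

theorem balance_idle (h : IsStationary (acsmaRate pathGraph H (uniformRate 3 H) a) μ)
    (c : ChannelState 3 H) :
    source μ c idle + (μ (left, c) * a.g 0 (c 0).1 + μ (right, c) * a.g 1 (c 1).1 +
      μ (centre, c) * a.g 2 (c 2).1) =
    μ (idle, c) * (a.f 0 (c 0).1 + a.f 1 (c 1).1 + a.f 2 (c 2).1) := by
  have := balance_source h c idle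
  simpa [sum_schedule, switchRate, Fin.sum_univ_three, idle, left, right, ends, centre,
    funext_iff, Fin.forall_fin_succ, Function.update_apply, ChannelState.level] using this

theorem balance_left (h : IsStationary (acsmaRate pathGraph H (uniformRate 3 H) a) μ)
    (c : ChannelState 3 H) :
    source μ c left + (μ (idle, c) * a.f 0 (c 0).1 + μ (ends, c) * a.g 1 (c 1).1) =
    μ (left, c) * (a.g 0 (c 0).1 + a.f 1 (c 1).1) := by
  have := balance_source h c left
  simpa [sum_schedule, switchRate, Fin.sum_univ_three, idle, left, right, ends, centre,
    funext_iff, Fin.forall_fin_succ, Function.update_apply, ChannelState.level] using this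

theorem balance_right (h : IsStationary (acsmaRate pathGraph H (uniformRate 3 H) a) μ)
    (c : ChannelState 3 H) :
    source μ c right + (μ (idle, c) * a.f 1 (c 1).1 + μ (ends, c) * a.g 0 (c 0).1) =
    μ (right, c) * (a.g 1 (c 1).1 + a.f 0 (c 0).1) := by
  have := balance_source h c right
  simpa [sum_schedule, switchRate, Fin.sum_univ_three, idle, left, right, ends, centre,
    funext_iff, Fin.forall_fin_succ, Function.update_apply, ChannelState.level] using this

theorem balance_ends (h : IsStationary (acsmaRate pathGraph H (uniformRate 3 H) a) μ)
    (c : ChannelState 3 H) :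
    source μ c ends + (μ (left, c) * a.f 1 (c 1).1 + μ (right, c) * a.f 0 (c 0).1) =
    μ (ends, c) * (a.g 1 (c 1).1 + a.g 0 (c 0).1) := by
  have := balance_source h c ends
  simpa [sum_schedule, switchRate, Fin.sum_univ_three, idle, left, right, ends, centre,
    funext_iff, Fin.forall_fin_succ, Function.update_apply, ChannelState.level] using this

end Balance

/-! Along a path of transitions that carries a net flow of positive sign, the ratio of the
probability of a state and its weight decreases. -/

theorem flow_centre_to_ends {f₁ f₂ f₃ g₁ g₂ g₃ p₀ p₁ p₁₂ p₃ : ℝ} (hf₁ : 0 < f₁) (hf₂ : 0 < f₂)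
    (hg₁ : 0 < g₁) (hg₃ : 0 < g₃) (hf₃ : 0 < f₃) (hp : 0 < p₁₂)
    (h30 : p₀ * f₃ < p₃ * g₃) (h01 : p₁ * g₁ < p₀ * f₁) (h12 : p₁₂ * g₂ < p₁ * f₂)
    (hle : p₃ ≤ p₁₂) :
    f₃ * (g₁ * g₂) < f₁ * f₂ * g₃ := by
  have e1 : p₁₂ * g₂ * (g₁ * f₃) < p₁ * f₂ * (g₁ * f₃) := by gcongr
  have e2 : p₁ * g₁ * (f₂ * f₃) < p₀ * f₁ * (f₂ * f₃) := by gcongr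
  have e3 : p₀ * f₃ * (f₁ * f₂) < p₃ * g₃ * (f₁ * f₂) := by gcongr
  have e4 : p₃ * (g₃ * (f₁ * f₂)) ≤ p₁₂ * (g₃ * (f₁ * f₂)) := by gcongr
  refine lt_of_mul_lt_mul_left (a := p₁₂) ?_ hp.le
  linarith

theorem flow_ends_to_centre {f₁ f₂ f₃ g₁ g₂ g₃ p₀ p₁ p₁₂ p₃ : ℝ} (hf₁ : 0 < f₁) (hf₂ : 0 < f₂)
    (hg₁ : 0 < g₁) (hg₂ : 0 < g₂) (hf₃ : 0 < f₃) (hp : 0 < p₃)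
    (h03 : p₃ * g₃ < p₀ * f₃) (h10 : p₀ * f₁ < p₁ * g₁) (h21 : p₁ * f₂ < p₁₂ * g₂)
    (hle : p₁₂ ≤ p₃) :
    f₁ * f₂ * g₃ < f₃ * (g₁ * g₂) := by
  have e1 : p₁ * f₂ * (g₁ * f₃) < p₁₂ * g₂ * (g₁ * f₃) := by gcongr
  have e2 : p₀ * f₁ * (f₂ * f₃) < p₁ * g₁ * (f₂ * f₃) := by gcongr
  have e3 : p₃ * g₃ * (f₁ * f₂) < p₀ * f₃ * (f₁ * f₂) := by gcongr
  have e4 : p₁₂ * (g₁ * g₂ * f₃) ≤ p₃ * (g₁ * g₂ * f₃) := by gcongr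
  refine lt_of_mul_lt_mul_left (a := p₃) ?_ hp.le
  linarith

end pathGraph
-- Optimal schedules on the path and comparison of weights
namespace pathGraph

variable {H : Finset unitInterval}

/-- A schedule of maximal throughput in the channel state `c`. -/
def best (c : ChannelState 3 H) : Schedule pathGraph :=
  if ((c 0).1 : ℝ) + (c 1).1 < (c 2).1 then centre else ends

theorem throughput_le_best (ρ : Schedule pathGraph) (c : ChannelState 3 H) :
    throughput ρ c ≤ throughput (best c) c := by
  have h0 : (0 : ℝ) ≤ (c 0).1 := (c 0).1.2.1
  have h1 : (0 : ℝ) ≤ (c 1).1 := (c 1).1.2.1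
  have hρ : ρ ∈ ({idle, left, right, ends, centre} : Finset (Schedule pathGraph)) := by
    rw [← univ_schedule]; exact Finset.mem_univ ρ
  simp only [Finset.mem_insert, Finset.mem_singleton] at hρ
  rcases hρ with rfl | rfl | rfl | rfl | rfl <;> unfold best <;> split_ifs <;>
    simp only [throughput_idle, throughput_left, throughput_right, throughput_ends,
      throughput_centre] <;> linarith

theorem log_lt_log_of_mul_lt {f₁ f₂ f₃ g₁ g₂ g₃ : ℝ} (hf₁ : 0 < f₁) (hf₂ : 0 < f₂)
    (hf₃ : 0 < f₃) (hg₁ : 0 < g₁) (hg₂ : 0 < g₂) (hg₃ : 0 < g₃)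
    (h : f₃ * (g₁ * g₂) < f₁ * f₂ * g₃) :
    Real.log (f₃ / g₃) < Real.log (f₁ / g₁) + Real.log (f₂ / g₂) := by
  rw [← Real.log_mul (by positivity) (by positivity)]
  refine Real.log_lt_log (by positivity) ?_
  rw [div_mul_div_comm, div_lt_div_iff₀ (by positivity) (by positivity)]
  exact h

theorem log_lt_log_of_lt_mul {f₁ f₂ f₃ g₁ g₂ g₃ : ℝ} (hf₁ : 0 < f₁) (hf₂ : 0 < f₂)
    (hg₁ : 0 < g₁) (hg₂ : 0 < g₂) (hg₃ : 0 < g₃)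
    (h : f₁ * f₂ * g₃ < f₃ * (g₁ * g₂)) :
    Real.log (f₁ / g₁) + Real.log (f₂ / g₂) < Real.log (f₃ / g₃) := by
  rw [← Real.log_mul (by positivity) (by positivity)]
  refine Real.log_lt_log (by positivity) ?_
  rw [div_mul_div_comm, div_lt_div_iff₀ (by positivity) (by positivity)]
  exact h

end pathGraph

open pathGraph in
/-- A schedule that is optimal in a channel state must have the larger product-form weight. -/
theorem OptimalityHolds.exists_weights {k : unitInterval → ℝ} (hopt : OptimalityHolds k)
    {H : Finset unitInterval} (h0 : (0 : unitInterval) ∉ H) (h1 : (1 : unitInterval) ∈ H)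
    {q : unitInterval} (hq : q ∈ H) (hq2 : (q : ℝ) + q < 1) :
    ∃ r : Fin 3 → ℝ, ∀ x ∈ H, ∀ y ∈ H, ∀ z ∈ H,
      ((z : ℝ) < x + y → r 2 * k z < r 0 * k x + r 1 * k y) ∧
      ((x : ℝ) + y < z → r 0 * k x + r 1 * k y < r 2 * k z) := by
  have hpos : ∀ x ∈ H, 0 < (x : ℝ) := by
    intro x hx
    refine lt_of_le_of_ne x.2.1 fun h => h0 ?_
    have h2 : x = 0 := Subtype.ext h.symm
    rwa [← h2]
  -- Two reference channel states, with `ends` optimal in `cE` and `centre` in `cC`; they guarantee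
  -- that both schedules carry substantial total mass.
  let cE : ChannelState 3 H := fun _ => ⟨1, h1⟩
  let cC : ChannelState 3 H := ![⟨q, hq⟩, ⟨q, hq⟩, ⟨1, h1⟩]
  have : Nonempty (ChannelState 3 H) := ⟨cE⟩
  set N : ℝ := (Fintype.card (ChannelState 3 H) : ℝ) with hN
  have hN1 : 1 ≤ N := by
    rw [hN]; exact_mod_cast Fintype.card_pos
  have hN0 : 0 < N := by linarith
  have hbE : best cE = ends := by
    rw [best, if_neg]; simp [cE]
  have hbC : best cC = centre := by
    rw [best, if_pos]; simpa [cC] using hq2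
  -- Each channel state has mass `20 * δ`. With `N * ε = δ`, a schedule that is suboptimal at `c`
  -- loses at most `δ` through channel jumps, while `ends` or `centre` gains at least `20 * δ - 4 *
  -- ε - δ ≥ 15 * δ`.
  set δ : ℝ := 1 / (20 * N) with hδ
  have hδpos : 0 < δ := by positivity
  set ε : ℝ := δ / N with hε
  have hεpos : 0 < ε := by positivity
  have hNε : N * ε = δ := by rw [hε]; field_simp
  have hεδ : ε ≤ δ := div_le_self hδpos.le hN1
  have hNδ : 1 / N = 20 * δ := by rw [hδ]; field_simp
  obtain ⟨a, ⟨r, hr⟩, μ, hμ, hconc⟩ := hopt.exists_concentrated pathGraph h0 h1 best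
    throughput_le_best (by
      intro i
      fin_cases i
      · exact ⟨cE, by rw [hbE]; rfl⟩
      · exact ⟨cE, by rw [hbE]; rfl⟩
      · exact ⟨cC, by rw [hbC]; rfl⟩) hεpos
  have hμ0 := hμ.1
  have hmarg : ∀ c, μ (idle, c) + μ (left, c) + μ (right, c) + μ (ends, c) + μ (centre, c) =
      20 * δ := fun c => by
    rw [← hNδ, hN, ← channel_marginal hμ c, sum_schedule]
  have hends : ∀ c : ChannelState 3 H, ((c 2).1 : ℝ) < ((c 0).1 : ℝ) + (c 1).1 →
      μ (idle, c) ≤ ε ∧ μ (left, c) ≤ ε ∧ μ (right, c) ≤ ε ∧ μ (centre, c) ≤ ε := by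
    intro c hc
    have hb : best c = ends := if_neg hc.not_gt
    have p0 := hpos _ (c 0).2
    have p1 := hpos _ (c 1).2
    refine ⟨hconc _ c ?_, hconc _ c ?_, hconc _ c ?_, hconc _ c ?_⟩ <;>
    simp only [hb, throughput_idle, throughput_left, throughput_right, throughput_ends,
      throughput_centre] <;> linarith
  have hcentre : ∀ c : ChannelState 3 H, ((c 0).1 : ℝ) + (c 1).1 < ((c 2).1 : ℝ) →
      μ (idle, c) ≤ ε ∧ μ (left, c) ≤ ε ∧ μ (right, c) ≤ ε ∧ μ (ends, c) ≤ ε := by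
    intro c hc
    have hb : best c = centre := if_pos hc
    have p0 := hpos _ (c 0).2
    have p1 := hpos _ (c 1).2
    refine ⟨hconc _ c ?_, hconc _ c ?_, hconc _ c ?_, hconc _ c ?_⟩ <;>
    simp only [hb, throughput_idle, throughput_left, throughput_right, throughput_ends,
      throughput_centre] <;> linarith
  have hmass : ∀ ρ c, μ (ρ, c) ≤ ∑ c', μ (ρ, c') := fun ρ c =>
    Finset.single_le_sum (f := fun c' => μ (ρ, c')) (fun c' _ => hμ0 _) (Finset.mem_univ c)
  have hsource : ∀ c ρ, μ (ρ, c) ≤ ε → -δ ≤ source μ c ρ := by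
    intro c ρ h
    have e1 : N * μ (ρ, c) ≤ δ := by rw [← hNε]; gcongr
    have e2 := (hμ0 (ρ, c)).trans (hmass ρ c)
    rw [source]
    linarith
  have hsourceE : ∀ c, μ (ends, c) ≤ ε → 15 * δ ≤ source μ c ends := by
    intro c h
    have e1 : N * μ (ends, c) ≤ δ := by rw [← hNε]; gcongr
    obtain ⟨e2, e3, e4, e5⟩ := hends cE (by simp [cE])
    have e6 := hmass ends cE
    have e7 := hmarg cE
    rw [source]
    linarith
  have hsourceC : ∀ c, μ (centre, c) ≤ ε → 15 * δ ≤ source μ c centre := by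
    intro c h
    have e1 : N * μ (centre, c) ≤ δ := by rw [← hNε]; gcongr
    obtain ⟨e2, e3, e4, e5⟩ := hcentre cC (by simpa [cC] using hq2)
    have e6 := hmass centre cC
    have e7 := hmarg cC
    rw [source]
    linarith
  refine ⟨r, fun x hx y hy z hz => ?_⟩
  set c : ChannelState 3 H := ![⟨x, hx⟩, ⟨y, hy⟩, ⟨z, hz⟩] with hc
  have b0 := balance_idle hμ c
  have b1 := balance_left hμ c
  have b2 := balance_right hμ c
  have b3 := balance_centre hμ c
  have b12 := balance_ends hμ c
  have hc0 : (c 0).1 = x := rfl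
  have hc1 : (c 1).1 = y := rfl
  have hc2 : (c 2).1 = z := rfl
  have hm := hmarg c
  rw [hc0, hc1, hc2] at b0
  rw [hc0, hc1] at b1 b2 b12
  rw [hc2] at b3
  rw [← hr 0 x, ← hr 1 y, ← hr 2 z]
  have pf0 := a.f_pos 0 x
  have pf1 := a.f_pos 1 y
  have pf2 := a.f_pos 2 z
  have pg0 := a.g_pos 0 x
  have pg1 := a.g_pos 1 y
  have pg2 := a.g_pos 2 z
  constructor
  · intro hlt
    obtain ⟨m0, m1, m2, m3⟩ := hends c (by rwa [hc0, hc1, hc2])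
    have s0 := hsource c _ m0
    have s1 := hsource c _ m1
    have s2 := hsource c _ m2
    have s3 := hsourceC c m3
    have hp : 0 < μ (ends, c) := by linarith
    have hle : μ (centre, c) ≤ μ (ends, c) := by linarith
    have h30 : μ (idle, c) * a.f 2 z < μ (centre, c) * a.g 2 z := by linarith
    refine log_lt_log_of_mul_lt pf0 pf1 pf2 pg0 pg1 pg2 ?_
    -- At least `14 * δ` of net flow leaves `idle` through `left` and `right` together, so one
    -- branch carries more than `δ`, which survives the loss of at most `δ` at its middle state.
    by_cases hJ : μ (left, c) * a.g 0 x + δ < μ (idle, c) * a.f 0 x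
    · exact flow_centre_to_ends (p₁ := μ (left, c)) pf0 pf1 pg0 pg2 pf2 hp h30 (by linarith)
        (by linarith) hle
    · have := flow_centre_to_ends (p₁ := μ (right, c)) (f₁ := a.f 1 y) (f₂ := a.f 0 x)
        (g₁ := a.g 1 y) (g₂ := a.g 0 x) pf1 pf0 pg1 pg2 pf2 hp h30 (by linarith)
        (by linarith) hle
      linarith
  · intro hlt
    obtain ⟨m0, m1, m2, m12⟩ := hcentre c (by rwa [hc0, hc1, hc2])
    have s0 := hsource c _ m0
    have s1 := hsource c _ m1
    have s2 := hsource c _ m2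
    have s12 := hsourceE c m12
    have hp : 0 < μ (centre, c) := by linarith
    have hle : μ (ends, c) ≤ μ (centre, c) := by linarith
    -- The net flow into `centre` is the sum of the other four sources, at least `15 * δ - 3 * δ`.
    have h03 : μ (centre, c) * a.g 2 z < μ (idle, c) * a.f 2 z := by linarith
    refine log_lt_log_of_lt_mul pf0 pf1 pg0 pg1 pg2 ?_
    by_cases hJ : μ (left, c) * a.f 1 y + δ < μ (ends, c) * a.g 1 y
    · exact flow_ends_to_centre (p₁ := μ (left, c)) pf0 pf1 pg0 pg1 pf2 hp h03 (by linarith)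
        (by linarith) hle
    · have := flow_ends_to_centre (p₁ := μ (right, c)) (f₁ := a.f 1 y) (f₂ := a.f 0 x)
        (g₁ := a.g 1 y) (g₂ := a.g 0 x) pf1 pf0 pg1 pg0 pf2 hp h03 (by linarith)
        (by linarith) hle
      linarith

/-! ### The functional equation -/

/-- Subtracting the linear part leaves an additive `F` with `F 1 = 0`. A maximum point of `|F|` may
be taken in `[0, 1 / 2]`, by reflection `F (1 - t) = -F t`; doubling it would double the maximum
unless that is zero. -/
theorem eq_mul_of_add_eq {K : ℝ → ℝ} (hK : ContinuousOn K (Icc 0 1))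
    (hadd : ∀ x y, 0 ≤ x → 0 ≤ y → x + y ≤ 1 → K x + K y = K (x + y)) {x : ℝ}
    (hx : x ∈ Icc (0 : ℝ) 1) : K x = K 1 * x := by
  have hFadd : ∀ x y, 0 ≤ x → 0 ≤ y → x + y ≤ 1 →
      (K x - K 1 * x) + (K y - K 1 * y) = K (x + y) - K 1 * (x + y) := by
    intro x y h1 h2 h3
    linarith [hadd x y h1 h2 h3]
  set F : ℝ → ℝ := fun x => K x - K 1 * x with hF
  have hFc : ContinuousOn (fun x => |F x|) (Icc 0 1) :=
    (hK.sub (continuousOn_const.mul continuousOn_id)).abs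
  obtain ⟨t, ht, hmax⟩ := isCompact_Icc.exists_isMaxOn ⟨0, by simp⟩ hFc
  have hhalf : ∀ s, 0 ≤ s → s ≤ 1 / 2 → |F s| = |F t| → |F t| = 0 := by
    intro s h1 h2 h3
    have h4 : F s + F s = F (s + s) := hFadd s s h1 h1 (by linarith)
    have h5 : |F (s + s)| ≤ |F t| := hmax ⟨by linarith, by linarith⟩
    rw [← h4, ← two_mul, abs_mul, abs_two, h3] at h5
    have := abs_nonneg (F t)
    linarith
  have ht0 : |F t| = 0 := by
    rcases le_total t (1 / 2) with h | h
    · exact hhalf t ht.1 h rfl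
    · refine hhalf (1 - t) (by linarith [ht.2]) (by linarith) ?_
      have h1 : F t + F (1 - t) = F (t + (1 - t)) :=
        hFadd t (1 - t) ht.1 (by linarith [ht.2]) (by linarith)
      have h2 : F (t + (1 - t)) = 0 := by simp [hF]
      have h3 : F (1 - t) = -F t := by linarith
      rw [h3, abs_neg]
  have h6 : |F x| ≤ |F t| := hmax hx
  rw [ht0] at h6
  have h7 : F x = 0 := abs_eq_zero.1 (le_antisymm h6 (abs_nonneg _))
  simp only [hF] at h7
  linarith

/-- Comparing the equation at `(0, s)`, `(s, 0)` and `(0, 0)`, where `K s ≠ K 0`, forces the three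
coefficients to agree. -/
theorem add_eq_of_weighted {K : ℝ → ℝ} {r : Fin 3 → ℝ} (hr : r ≠ 0)
    (hK : ∃ s ∈ Icc (0 : ℝ) 1, K s ≠ K 0)
    (h : ∀ x y, 0 ≤ x → 0 ≤ y → x + y ≤ 1 → r 0 * K x + r 1 * K y = r 2 * K (x + y)) :
    ∀ x y, 0 ≤ x → 0 ≤ y → x + y ≤ 1 → K x + K y = K (x + y) := by
  obtain ⟨s, hs, hne⟩ := hK
  have e1 := h 0 s le_rfl hs.1 (by linarith [hs.2])
  have e2 := h s 0 hs.1 le_rfl (by linarith [hs.2])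
  have e3 := h 0 0 le_rfl le_rfl (by norm_num)
  rw [zero_add] at e1
  rw [add_zero] at e2 e3
  have h01 : r 0 = r 1 := by
    refine mul_right_cancel₀ (sub_ne_zero.2 hne) ?_
    linarith
  have h02 : r 0 = r 2 := by
    refine mul_right_cancel₀ (sub_ne_zero.2 hne) ?_
    rw [← h01] at e1 e3
    linarith
  have h0 : r 0 ≠ 0 := by
    intro h0
    apply hr
    ext i
    fin_cases i
    · exact h0
    · exact h01 ▸ h0
    · exact h02 ▸ h0
  intro x y hx hy hxy
  refine mul_left_cancel₀ h0 ?_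
  have := h x y hx hy hxy
  rw [← h01, ← h02] at this
  linarith

/-- The points `x`, `y`, `x + y` are approached by triples for which the comparison is strict, once
in each direction. The maps `w ↦ (1 - a * d) * w + b * d` with `b ≤ a` keep them in `(0, 1]` even
when `x` or `y` is `0` or `x + y = 1`: the shifts satisfy `1 + 1 < 3` in one direction and `1 < 1 +
1` in the other. -/
theorem weighted_eq_of_le {K : ℝ → ℝ} (hK : Continuous K) {r : Fin 3 → ℝ}
    (hle : ∀ x ∈ Ioc (0 : ℝ) 1, ∀ y ∈ Ioc (0 : ℝ) 1, ∀ z ∈ Ioc (0 : ℝ) 1,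
      (z < x + y → r 2 * K z ≤ r 0 * K x + r 1 * K y) ∧
      (x + y < z → r 0 * K x + r 1 * K y ≤ r 2 * K z))
    {x y : ℝ} (hx : 0 ≤ x) (hy : 0 ≤ y) (hxy : x + y ≤ 1) :
    r 0 * K x + r 1 * K y = r 2 * K (x + y) := by
  have hev : ∀ᶠ d : ℝ in 𝓝[>] 0, 0 < d ∧ d < 1 / 8 :=
    Eventually.and self_mem_nhdsWithin (nhdsWithin_le_nhds (gt_mem_nhds (by norm_num)))
  have hlim : ∀ (w a b : ℝ), Tendsto (fun d : ℝ => K ((1 - a * d) * w + b * d)) (𝓝[>] 0)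
      (𝓝 (K w)) := by
    intro w a b
    have hc : Continuous fun d : ℝ => K ((1 - a * d) * w + b * d) := by fun_prop
    have := (hc.tendsto 0).mono_left (nhdsWithin_le_nhds (s := Ioi (0 : ℝ)))
    simpa using this
  have hmem : ∀ w a b d : ℝ, 0 ≤ w → w ≤ 1 → 0 < d → d < 1 / 8 → b ≤ a → 0 < b → a ≤ 4 →
      (1 - a * d) * w + b * d ∈ Ioc (0 : ℝ) 1 := by
    intro w a b d hw hw1 hd hd1 hba hb ha
    have had : a * d ≤ 1 / 2 := by nlinarith
    have hbd : 0 < b * d := mul_pos hb hd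
    have hbad : b * d ≤ a * d := by gcongr
    constructor
    · nlinarith
    · nlinarith
  apply le_antisymm
  · refine le_of_tendsto_of_tendsto (((hlim x 4 1).const_mul (r 0)).add
      ((hlim y 4 1).const_mul (r 1))) ((hlim (x + y) 4 3).const_mul (r 2)) ?_
    filter_upwards [hev] with d hd
    refine (hle _ (hmem x 4 1 d hx (by linarith) hd.1 hd.2 ?_ ?_ ?_)
      _ (hmem y 4 1 d hy (by linarith) hd.1 hd.2 ?_ ?_ ?_)
      _ (hmem (x + y) 4 3 d (by linarith) hxy hd.1 hd.2 ?_ ?_ ?_)).2 ?_ <;>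
    norm_num
    linarith [hd.1]
  · refine le_of_tendsto_of_tendsto ((hlim (x + y) 2 1).const_mul (r 2))
      (((hlim x 2 1).const_mul (r 0)).add ((hlim y 2 1).const_mul (r 1))) ?_
    filter_upwards [hev] with d hd
    refine (hle _ (hmem x 2 1 d hx (by linarith) hd.1 hd.2 ?_ ?_ ?_)
      _ (hmem y 2 1 d hy (by linarith) hd.1 hd.2 ?_ ?_ ?_)
      _ (hmem (x + y) 2 1 d (by linarith) hxy hd.1 hd.2 ?_ ?_ ?_)).1 ?_ <;>
    norm_num
    linarith [hd.1]

/-- The channel level `1 / 4`. -/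
def quarter : unitInterval := ⟨1 / 4, by norm_num, by norm_num⟩

theorem quarter_ne_zero : quarter ≠ 0 := by
  intro h
  have := congrArg Subtype.val h
  norm_num [quarter] at this

theorem quarter_add_quarter_lt : (quarter : ℝ) + quarter < 1 := by
  norm_num [quarter]

/-! ### From finite sets of levels to the whole interval -/

theorem OptimalityHolds.not_constant {k : unitInterval → ℝ} (hopt : OptimalityHolds k) :
    k quarter ≠ k 1 := by
  intro heq
  obtain ⟨r, hr⟩ := hopt.exists_weights (H := {1, quarter}) (q := quarter)
    (by simp [quarter_ne_zero.symm]) (by simp) (by simp) quarter_add_quarter_lt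
  -- Equal values of `k` at `1 / 4` and `1` would make the weights compare in opposite ways, since
  -- `1 < 1 + 1` but `1 / 4 + 1 / 4 < 1`.
  have e1 := (hr 1 (by simp) 1 (by simp) 1 (by simp)).1 (by simp)
  have e2 := (hr quarter (by simp) quarter (by simp) 1 (by simp)).2 quarter_add_quarter_lt
  rw [heq] at e2
  linarith

/-- The constraints are homogeneous in `r` and closed once weakened, so the finite intersection
property on the unit sphere applies. Finitely many constraints involve finitely many levels, which
together with `1` and `quarter` form an admissible `H`. -/
theorem OptimalityHolds.exists_limit_weights {k : unitInterval → ℝ} (hopt : OptimalityHolds k) :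
    ∃ r : Fin 3 → ℝ, r ≠ 0 ∧ ∀ x y z : unitInterval, x ≠ 0 → y ≠ 0 → z ≠ 0 →
      ((z : ℝ) < x + y → r 2 * k z ≤ r 0 * k x + r 1 * k y) ∧
      ((x : ℝ) + y < z → r 0 * k x + r 1 * k y ≤ r 2 * k z) := by
  let U : Type := {x : unitInterval // x ≠ 0}
  let T : U × U × U → Set (Fin 3 → ℝ) := fun p => {r |
    ((p.2.2.1 : ℝ) < p.1.1 + p.2.1.1 → r 2 * k p.2.2.1 ≤ r 0 * k p.1.1 + r 1 * k p.2.1.1) ∧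
    ((p.1.1 : ℝ) + p.2.1.1 < p.2.2.1 → r 0 * k p.1.1 + r 1 * k p.2.1.1 ≤ r 2 * k p.2.2.1)}
  have hclosed : ∀ p, IsClosed (T p) := by
    intro p
    refine IsClosed.inter ?_ ?_
    · refine isClosed_imp isOpen_const (isClosed_le (by fun_prop) (by fun_prop))
    · refine isClosed_imp isOpen_const (isClosed_le (by fun_prop) (by fun_prop))
  obtain ⟨r, hr, hrT⟩ := (isCompact_sphere (0 : Fin 3 → ℝ) 1).inter_iInter_nonempty T hclosed (by
    intro u
    classical
    let H : Finset unitInterval := {1, quarter} ∪ (u.image (fun p => p.1.1) ∪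
      (u.image (fun p => p.2.1.1) ∪ u.image (fun p => p.2.2.1)))
    have h0 : (0 : unitInterval) ∉ H := by
      simp only [H, Finset.mem_union, Finset.mem_insert, Finset.mem_singleton, Finset.mem_image]
      rintro ((h | h) | ⟨p, _, h⟩ | ⟨p, _, h⟩ | ⟨p, _, h⟩)
      · exact zero_ne_one h
      · exact quarter_ne_zero h.symm
      · exact p.1.2 h
      · exact p.2.1.2 h
      · exact p.2.2.2 h
    have h1 : (1 : unitInterval) ∈ H := by simp [H]
    obtain ⟨r, hr⟩ := hopt.exists_weights h0 h1 (q := quarter) (by simp [H])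
      quarter_add_quarter_lt
    -- The strict inequality at levels `1, 1, 1` rules out `r = 0`; it has to be used before passing
    -- to weak inequalities.
    have hr0 : r ≠ 0 := by
      rintro rfl
      have := (hr 1 h1 1 h1 1 h1).1 (by simp)
      simp at this
    have hnorm : 0 < ‖r‖⁻¹ := inv_pos.2 (norm_pos_iff.2 hr0)
    refine ⟨‖r‖⁻¹ • r, ?_, mem_iInter₂.2 fun p hp => ?_⟩
    · simp [norm_smul, hr0]
    · have hx : p.1.1 ∈ H := by
        simp only [H, Finset.mem_union, Finset.mem_image]; exact Or.inr (Or.inl ⟨p, hp, rfl⟩)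
      have hy : p.2.1.1 ∈ H := by
        simp only [H, Finset.mem_union, Finset.mem_image]
        exact Or.inr (Or.inr (Or.inl ⟨p, hp, rfl⟩))
      have hz : p.2.2.1 ∈ H := by
        simp only [H, Finset.mem_union, Finset.mem_image]
        exact Or.inr (Or.inr (Or.inr ⟨p, hp, rfl⟩))
      obtain ⟨ha, hb⟩ := hr _ hx _ hy _ hz
      refine ⟨fun h => ?_, fun h => ?_⟩
      · have := mul_le_mul_of_nonneg_left (ha h).le hnorm.le
        simp only [Pi.smul_apply, smul_eq_mul]
        linarith
      · have := mul_le_mul_of_nonneg_left (hb h).le hnorm.le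
        simp only [Pi.smul_apply, smul_eq_mul]
        linarith)
  refine ⟨r, ?_, fun x y z hx hy hz => mem_iInter.1 hrT (⟨x, hx⟩, ⟨y, hy⟩, ⟨z, hz⟩)⟩
  rintro rfl
  simp at hr

theorem OptimalityHolds.eq_mul {k : unitInterval → ℝ} (hk : Continuous k)
    (hopt : OptimalityHolds k) (x : unitInterval) : k x = k 1 * x := by
  obtain ⟨r, hr0, hr⟩ := hopt.exists_limit_weights
  set K : ℝ → ℝ := IccExtend zero_le_one k with hKdef
  have hK : Continuous K := hk.Icc_extend'
  have hKk : ∀ x : unitInterval, K x = k x := fun x => IccExtend_val _ k x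
  have hmem : ∀ s ∈ Ioc (0 : ℝ) 1, ∃ t : unitInterval, t ≠ 0 ∧ (t : ℝ) = s := fun s hs =>
    ⟨⟨s, hs.1.le, hs.2⟩, fun h => hs.1.ne' (congrArg Subtype.val h), rfl⟩
  have hle : ∀ x ∈ Ioc (0 : ℝ) 1, ∀ y ∈ Ioc (0 : ℝ) 1, ∀ z ∈ Ioc (0 : ℝ) 1,
      (z < x + y → r 2 * K z ≤ r 0 * K x + r 1 * K y) ∧
      (x + y < z → r 0 * K x + r 1 * K y ≤ r 2 * K z) := by
    intro x hx y hy z hz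
    obtain ⟨x, hx0, rfl⟩ := hmem x hx
    obtain ⟨y, hy0, rfl⟩ := hmem y hy
    obtain ⟨z, hz0, rfl⟩ := hmem z hz
    simp only [hKk]
    exact hr x y z hx0 hy0 hz0
  have hnc : ∃ s ∈ Icc (0 : ℝ) 1, K s ≠ K 0 := by
    by_contra! hcon
    have e1 := hcon _ quarter.2
    have e2 := hcon _ (1 : unitInterval).2
    rw [hKk] at e1 e2
    exact hopt.not_constant (e1.trans e2.symm)
  have hadd := add_eq_of_weighted hr0 hnc fun x y hx hy hxy => weighted_eq_of_le hK hle hx hy hxy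
  have h1 := eq_mul_of_add_eq hK.continuousOn hadd x.2
  have h2 : K 1 = k 1 := hKk 1
  rwa [hKk, h2] at h1

end CSMA

end

theorem theorem3p2 (k : unitInterval → ℝ) (hk_cont : Continuous k) (hk_nonneg : ∀ x, 0 ≤ k x)
    (hopt : CSMA.OptimalityHolds k) :
    (∀ n : ℕ, CSMA.expKACSMA n k = CSMA.expACSMA n) ∧
      ∃ b : ℝ, 0 < b ∧ ∀ x : unitInterval, k x = b * (x : ℝ) := by
  have hlin := hopt.eq_mul hk_cont
  have hb : 0 < k 1 := by
    -- If `k 1` vanished, linearity would make `k` identically zero.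
    refine lt_of_le_of_ne (hk_nonneg 1) fun h => hopt.not_constant ?_
    rw [hlin CSMA.quarter, ← h, zero_mul]
  refine ⟨fun n => ?_, k 1, hb, hlin⟩
  ext a
  constructor
  · rintro ⟨r, hr⟩
    exact ⟨fun i => r i * k 1, fun i x => by rw [hr, hlin x, mul_assoc]⟩
  · rintro ⟨r, hr⟩
    refine ⟨fun i => r i / k 1, fun i x => ?_⟩
    rw [hr, hlin x]
    field_simp
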